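/- Let $\xi(x)\in\mathbb{C}[[x]]$ be a formal power series with $\xi(0)=0$ and let $t\ge 1$ be a real number. For $f\in\mathbb{C}[x,y]$ put \[ v_{\xi,t}(f)=\operatorname{ord}_x\bigl(f(x,\xi(x)+\theta x^t)\bigr), \] where $\theta$ is transcendental over $\mathbb{C}$; this is a valuation $v=v_{\xi,t}$ centered at $p=(0,0)\in\mathbb{A}^2\subset\mathbb{P}^2$. Let $\mathcal{I}_m\subset\mathcal{O}_{\mathbb{P}^2}$ be its valuation ideal sheaf $(f\mid v(f)\ge m)$, let $\mathcal{O}_{\mathbb{P}^2,p}$ be the local ring at $p$, and define \[ \operatorname{vol}(v)=\lim_{m\to\infty}\frac{\dim_{\mathbb{C}}\bigl(\mathcal{O}_{\mathbb{P}^2,p}/\mathcal{I}_{m,p}\bigr)}{m^2/2},\qquad \widehat\mu(\xi,t)=\lim_{d\to\infty}\frac{\mu_d(v)}{d}, \] where $\mu_d(v)$ is the largest integer $m$ such that some nonzero homogeneous form $F\in\mathbb{C}[w_1,w_2,w_3]$ of degree $d$ satisfies $v(F(1,x,y))\ge m$. Both limits exist and $\operatorname{vol}(v)>0$. Moreover,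 writing $\deg$ for the total degree: 1. If $f\in\mathbb{C}[x,y]$ is an irreducible polynomial with $v_{\xi,t}(f)>\frac{1}{\sqrt{\operatorname{vol}(v_{\xi,t})}}\deg(f)$, then $v_{\xi,t}(f)=\widehat\mu(\xi,t)\cdot\deg(f)$ (one says that $f$ computes $\widehat\mu(\xi,t)$). 2. If $\widehat\mu(\xi,t)>\frac{1}{\sqrt{\operatorname{vol}(v_{\xi,t})}}$, then there is an irreducible polynomial $f\in\mathbb{C}[x,y]$ with $v_{\xi,t}(f)>\frac{1}{\sqrt{\operatorname{vol}(v_{\xi,t})}}\deg(f)$. -/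

import Mathlib

open Filter Topology

noncomputable section

namespace QuasiMonomial

/-- The affine coordinate ring `ℂ[x, y]` of the chart `𝔸² ⊂ ℙ²`, where `x = X 0`, `y = X 1`. -/
abbrev Poly2 : Type := MvPolynomial (Fin 2) ℂ

/-- Generalized power series in `x` with real exponents and coefficients in `ℂ[θ]`;
the indeterminate `θ` of `Polynomial ℂ` is transcendental over `ℂ`. -/
abbrev GenSeries : Type := HahnSeries ℝ (Polynomial ℂ)

/-- The power series `ξ(x)`, read as a generalized power series. -/
def toGenSeries (ξ : PowerSeries ℂ) : GenSeries :=
  HahnSeries.ofPowerSeries ℝ (Polynomial ℂ) (PowerSeries.map Polynomial.C ξ)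

/-- The substitution `f(x, y) ↦ f(x, ξ(x) + θ x ^ t)`. -/
def subst (ξ : PowerSeries ℂ) (t : ℝ) : Poly2 →ₐ[ℂ] GenSeries :=
  MvPolynomial.aeval
    ![HahnSeries.single (1 : ℝ) (1 : Polynomial ℂ),
      toGenSeries ξ + HahnSeries.single t (Polynomial.X : Polynomial ℂ)]

/-- The quasimonomial valuation `v_{ξ,t}(f) = ord_x (f(x, ξ(x) + θ x ^ t))`, with value `⊤`
exactly when the substituted series vanishes. -/
def val (ξ : PowerSeries ℂ) (t : ℝ) (f : Poly2) : WithTop ℝ :=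
  (subst ξ t f).orderTop

/-- The maximal ideal of the origin `p = (0, 0)` in `ℂ[x, y]`. -/
def originIdeal : Ideal Poly2 :=
  RingHom.ker (MvPolynomial.constantCoeff : Poly2 →+* ℂ)

instance originIdeal_isPrime : originIdeal.IsPrime :=
  RingHom.ker_isPrime _

/-- The local ring `𝒪_{ℙ²,p}`. -/
abbrev LocalRing : Type := Localization.AtPrime originIdeal

/-- The valuation ideal `(f ∈ ℂ[x, y] | v(f) ≥ m)`: the sections over `𝔸²` of the valuation ideal
sheaf `𝓘_m`. When `v` is a valuation that is non-negative on `ℂ[x, y]`, the generating set is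
already an ideal. -/
def valIdeal (v : Poly2 → WithTop ℝ) (m : ℝ) : Ideal Poly2 :=
  Ideal.span {f | (m : WithTop ℝ) ≤ v f}

/-- The stalk at `p` of the valuation ideal sheaf `𝓘_m`. -/
def valIdealStalk (v : Poly2 → WithTop ℝ) (m : ℝ) : Ideal LocalRing :=
  (valIdeal v m).map (algebraMap Poly2 LocalRing)

/-- The quotient `dim_ℂ (𝒪 / 𝓘_m) / (m ^ 2 / 2!)`, whose limit is the volume. The sheaf `𝒪 / 𝓘_m`
is supported at `p` when `v` is centered there, so that its dimension is that of its stalk. -/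
def volRatio (v : Poly2 → WithTop ℝ) (m : ℝ) : ℝ :=
  (Module.finrank ℂ (LocalRing ⧸ valIdealStalk v m) : ℝ) / (m ^ 2 / 2)

/-- The volume of a valuation centered at `p`. -/
def vol (v : Poly2 → WithTop ℝ) : ℝ :=
  limUnder atTop (volRatio v)

/-- Dehomogenization `F(w₁, w₂, w₃) ↦ F(1, x, y)`. -/
def dehom : MvPolynomial (Fin 3) ℂ →ₐ[ℂ] Poly2 :=
  MvPolynomial.aeval ![1, MvPolynomial.X 0, MvPolynomial.X 1]

/-- `μ_d(v) = max {m ∈ ℤ | [I_m]_d ≠ 0}`, where `[I_m]_d` consists of the homogeneous forms `F` of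
degree `d` on `ℙ²` with `v(F) = v(F(1, x, y)) ≥ m`. -/
def mu (v : Poly2 → WithTop ℝ) (d : ℕ) : ℤ :=
  sSup {m : ℤ | ∃ F : MvPolynomial (Fin 3) ℂ,
    F ≠ 0 ∧ F.IsHomogeneous d ∧ ((m : ℝ) : WithTop ℝ) ≤ v (dehom F)}

/-- The constant `μ̂(v) = lim_{d → ∞} μ_d(v) / d`. -/
def muHat (v : Poly2 → WithTop ℝ) : ℝ :=
  limUnder atTop (fun d : ℕ => (mu v d : ℝ) / (d : ℝ))

end QuasiMonomial

end

/-!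
In the coordinate `y - p(x)`, with `p` a truncation of `ξ` beyond degree `t`, the valuation `v` is
the monomial valuation of weights `1` and `t` (`exists_shift_le_val_iff`). Its valuation ideal of
level `m` therefore has as colength the number of monomials `x ^ i y ^ j` with `i + t j < m`, which
is `m ^ 2 / (2 t) + O(m)`. Since a polynomial that does not vanish at the origin has value `0`, the
colength does not change on passing to the local ring. Hence `vol(v) = 1 / t` (`vol_val`), and
the bound in the theorem is `√t * deg f`.

Forms of degree `d` correspond to polynomials of degree at most `d`, so `μ_d` is the integral part
of the largest value on nonzero polynomials of degree at most `d`. It is superadditive and at most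
linear in `d`, and Fekete's lemma gives the limit `μ̂`, with `v(f) ≤ μ̂ * deg f` for all `f ≠ 0`
(`ord_le_muHat_mul`). Value and degree are both additive on products, so `μ̂ ≤ c` as soon as
`v(f) ≤ c * deg f` for all irreducible `f` (`muHat_le_of_forall_irreducible`). With `c = √t` this
gives the existence of an irreducible `f` with `v(f) > √t * deg f` when `μ̂ > √t`.

That such an `f` computes `μ̂` follows from the inequality `v(f) v(g) ≤ t * deg f * deg g` for
coprime `f`, `g` (`ord_mul_ord_le`), a form of Bézout's theorem that is proved by counting
dimensions. In degree at most `D`, large, the multiples of `f` together with those of `g` have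
codimension at most `deg f * deg g`. Their images in the space of jets of level `m` have dimensions
at most the colengths of levels `m - v(f)` and `m - v(g)`. So the colength of level `m` exceeds the
sum of these two by at most `deg f * deg g`; this is applied to `f ^ k`, `g ^ k` with
`m = k (v(f) + v(g))`, and compared at order `k ^ 2`.
-/

noncomputable section

namespace QuasiMonomial

open MvPolynomial

/-! ### The weight of a monomial -/

/-- The weight `i + t j` of the monomial `x ^ i y ^ j`. -/
def weight (t : ℝ) (n : Fin 2 →₀ ℕ) : ℝ := n 0 + t * n 1

theorem weight_nonneg {t : ℝ} (ht : 1 ≤ t) (n : Fin 2 →₀ ℕ) : 0 ≤ weight t n := by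
  unfold weight; positivity

theorem weight_le_mul_degree {t : ℝ} (ht : 1 ≤ t) (n : Fin 2 →₀ ℕ) :
    weight t n ≤ t * n.degree := by
  have h : n.degree = n 0 + n 1 := by simp [Finsupp.degree_eq_sum]
  rw [h, weight]
  push_cast
  nlinarith [(n 0).cast_nonneg (α := ℝ)]

/-! ### Shifts of the coordinate `y` -/

section Shift

/-- The shift `f(x, y) ↦ f(x, y + p(x))`, as an algebra endomorphism. -/
def shiftHom (p : Polynomial ℂ) : Poly2 →ₐ[ℂ] Poly2 :=
  aeval ![X 0, X 1 + Polynomial.aeval (X 0) p]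

theorem shiftHom_X_zero (p : Polynomial ℂ) : shiftHom p (X 0) = X 0 := by simp [shiftHom]

theorem shiftHom_comp_shiftHom (p q : Polynomial ℂ) (h : p + q = 0) :
    (shiftHom p).comp (shiftHom q) = AlgHom.id ℂ Poly2 := by
  apply MvPolynomial.algHom_ext
  intro i
  fin_cases i
  · simp [shiftHom]
  · have h' : shiftHom p (Polynomial.aeval (X 0) q) = Polynomial.aeval (X 0) q := by
      rw [← Polynomial.aeval_algHom_apply, shiftHom_X_zero]
    have h2 : shiftHom q (X 1) = X 1 + Polynomial.aeval (X 0) q := by simp [shiftHom]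
    have h3 : shiftHom p (X 1) = X 1 + Polynomial.aeval (X 0) p := by simp [shiftHom]
    simp only [Fin.mk_one, AlgHom.coe_comp, Function.comp_apply, AlgHom.coe_id, id_eq]
    rw [h2, map_add, h', h3, add_assoc, ← map_add, h, map_zero, add_zero]

/-- The automorphism `f(x, y) ↦ f(x, y + p(x))` of `ℂ[x, y]`. -/
def shift (p : Polynomial ℂ) : Poly2 ≃ₐ[ℂ] Poly2 :=
  AlgEquiv.ofAlgHom (shiftHom p) (shiftHom (-p))
    (shiftHom_comp_shiftHom _ _ (by simp)) (shiftHom_comp_shiftHom _ _ (by simp))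

theorem shift_apply (p : Polynomial ℂ) (f : Poly2) : shift p f = shiftHom p f := rfl

theorem constantCoeff_shift (p : Polynomial ℂ) (hp : p.coeff 0 = 0) (f : Poly2) :
    constantCoeff (shift p f) = constantCoeff f := by
  have : ((constantCoeff : Poly2 →+* ℂ).comp (shiftHom p : Poly2 →+* Poly2)) = constantCoeff := by
    apply MvPolynomial.ringHom_ext
    · intro r; simp [shiftHom]
    · intro i
      fin_cases i
      · simp [shiftHom]
      · have : constantCoeff (Polynomial.aeval (X 0 : Poly2) p) = 0 := by
          rw [Polynomial.aeval_def, Polynomial.hom_eval₂]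
          simp [Polynomial.eval₂_at_zero, hp]
        simp [shiftHom, this]
  exact congrArg (fun h : Poly2 →+* ℂ => h f) this

theorem totalDegree_polynomial_aeval_le (p : Polynomial ℂ) (q : Poly2) :
    (Polynomial.aeval q p).totalDegree ≤ p.natDegree * q.totalDegree := by
  rw [Polynomial.aeval_eq_sum_range]
  refine (totalDegree_finsetSum _ _).trans (Finset.sup_le fun i hi => ?_)
  refine (totalDegree_smul_le _ _).trans ((totalDegree_pow _ _).trans ?_)
  exact Nat.mul_le_mul_right _ (by simpa [Nat.lt_succ_iff] using hi)

theorem totalDegree_shift_le (p : Polynomial ℂ) (f : Poly2) :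
    (shift p f).totalDegree ≤ max 1 p.natDegree * f.totalDegree := by
  have hX : ∀ i, ((![X 0, X 1 + Polynomial.aeval (X 0) p] : Fin 2 → Poly2) i).totalDegree ≤
      max 1 p.natDegree := by
    intro i
    fin_cases i
    · simp
    · refine (totalDegree_add _ _).trans (max_le_max (by simp) ?_)
      simpa using totalDegree_polynomial_aeval_le p (X 0)
  rw [shift_apply, shiftHom, aeval_def, eval₂_eq]
  refine (totalDegree_finsetSum _ _).trans (Finset.sup_le fun n hn => ?_)
  refine (totalDegree_mul _ _).trans ?_
  rw [MvPolynomial.algebraMap_eq, totalDegree_C, zero_add]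
  refine (totalDegree_finsetProd _ _).trans ?_
  have h1 : ∑ i ∈ n.support, n i ≤ f.totalDegree := le_totalDegree hn
  calc ∑ i ∈ n.support, ((![X 0, X 1 + Polynomial.aeval (X 0) p] i : Poly2) ^ n i).totalDegree
      ≤ ∑ i ∈ n.support, n i * max 1 p.natDegree :=
        Finset.sum_le_sum fun i _ => (totalDegree_pow _ _).trans (Nat.mul_le_mul_left _ (hX i))
    _ = (∑ i ∈ n.support, n i) * max 1 p.natDegree := by rw [Finset.sum_mul]
    _ ≤ _ := by rw [mul_comm]; exact Nat.mul_le_mul_left _ h1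

end Shift

/-! ### Substitution of generalized power series -/

section Series

theorem toGenSeries_add (ξ η : PowerSeries ℂ) :
    toGenSeries (ξ + η) = toGenSeries ξ + toGenSeries η := by
  simp [toGenSeries]

theorem algebraMap_genSeries (a : ℂ) :
    algebraMap ℂ GenSeries a = HahnSeries.single (0 : ℝ) (Polynomial.C a) := by
  rw [HahnSeries.algebraMap_apply', PowerSeries.algebraMap_apply, HahnSeries.ofPowerSeries_C]
  rfl

theorem toGenSeries_coe (p : Polynomial ℂ) :
    toGenSeries (p : PowerSeries ℂ) =
      Polynomial.aeval (HahnSeries.single (1 : ℝ) (1 : Polynomial ℂ) : GenSeries) p := by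
  have h : ((HahnSeries.ofPowerSeries ℝ (Polynomial ℂ)).comp
      ((PowerSeries.map (Polynomial.C : ℂ →+* Polynomial ℂ)).comp
        (Polynomial.coeToPowerSeries.ringHom : Polynomial ℂ →+* PowerSeries ℂ))) =
      (Polynomial.aeval (HahnSeries.single (1 : ℝ) (1 : Polynomial ℂ) : GenSeries) :
        Polynomial ℂ →ₐ[ℂ] GenSeries).toRingHom := by
    apply Polynomial.ringHom_ext
    · intro a
      simp [algebraMap_genSeries]
    · simp
  exact congrArg (fun h : Polynomial ℂ →+* GenSeries => h p) h

theorem subst_X_zero (ξ : PowerSeries ℂ) (t : ℝ) :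
    subst ξ t (X 0) = HahnSeries.single (1 : ℝ) (1 : Polynomial ℂ) := by simp [subst]

theorem subst_X_one (ξ : PowerSeries ℂ) (t : ℝ) :
    subst ξ t (X 1) =
      toGenSeries ξ + HahnSeries.single t (Polynomial.X : Polynomial ℂ) := by simp [subst]

/-- Subtracting a polynomial from `ξ` amounts to shifting the coordinate `y`. -/
theorem subst_shift (ξ : PowerSeries ℂ) (t : ℝ) (p : Polynomial ℂ) (f : Poly2) :
    subst ξ t (shift p f) = subst (ξ + p) t f := by
  have h : (subst ξ t).comp (shiftHom p) = subst (ξ + p) t := by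
    apply MvPolynomial.algHom_ext
    intro i
    fin_cases i
    · simp [shiftHom, subst]
    · have h3 : shiftHom p (X 1) = X 1 + Polynomial.aeval (X 0) p := by simp [shiftHom]
      simp only [Fin.mk_one, AlgHom.coe_comp, Function.comp_apply]
      rw [h3, map_add, ← Polynomial.aeval_algHom_apply, subst_X_zero, subst_X_one, subst_X_one,
        toGenSeries_add, toGenSeries_coe]
      ring
  exact congrArg (fun h : Poly2 →ₐ[ℂ] GenSeries => h f) h

theorem lt_orderTop_toGenSeries {η : PowerSeries ℂ} {t : ℝ}
    (h : ∀ i : ℕ, (i : ℝ) ≤ t → PowerSeries.coeff i η = 0) :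
    (t : WithTop ℝ) < (toGenSeries η).orderTop := by
  by_contra! hle
  have hne : toGenSeries η ≠ 0 := by
    intro h0
    simp [h0] at hle
  have hc := HahnSeries.coeff_orderTop_ne (x := toGenSeries η)
    (HahnSeries.order_eq_orderTop_of_ne_zero hne).symm
  rw [← HahnSeries.order_eq_orderTop_of_ne_zero hne, WithTop.coe_le_coe] at hle
  rw [toGenSeries, HahnSeries.ofPowerSeries_apply] at hc
  by_cases hr : ∃ i : ℕ, (i : ℝ) = (toGenSeries η).order
  · obtain ⟨i, hi⟩ := hr
    have := HahnSeries.ofPowerSeries_apply_coeff (Γ := ℝ) (R := Polynomial ℂ)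
      (PowerSeries.map Polynomial.C η) i
    rw [HahnSeries.ofPowerSeries_apply, hi] at this
    apply hc
    rw [toGenSeries, HahnSeries.ofPowerSeries_apply] at this
    rw [this, PowerSeries.coeff_map, h i (by rw [hi]; exact hle), map_zero]
  · apply hc
    rw [toGenSeries, HahnSeries.ofPowerSeries_apply] at hr
    apply HahnSeries.embDomain_of_notMem_range
    rintro ⟨i, hi⟩
    exact hr ⟨i, hi⟩

end Series

/-! ### The monomial case -/

section Monomial

variable {η : PowerSeries ℂ} {t : ℝ}

theorem subst_X_one_lead (hη : (t : WithTop ℝ) < (toGenSeries η).orderTop) :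
    (subst η t (X 1)).orderTop = t ∧ (subst η t (X 1)).leadingCoeff = Polynomial.X := by
  have h1 : (HahnSeries.single t (Polynomial.X : Polynomial ℂ) : GenSeries).orderTop = t :=
    HahnSeries.orderTop_single Polynomial.X_ne_zero
  rw [subst_X_one]
  constructor
  · rw [HahnSeries.orderTop_add_eq_right (by rwa [h1]), h1]
  · rw [HahnSeries.leadingCoeff_add_eq_right (by rwa [h1]), HahnSeries.leadingCoeff_of_single]

theorem subst_monomial_lead (hη : (t : WithTop ℝ) < (toGenSeries η).orderTop)
    (n : Fin 2 →₀ ℕ) {c : ℂ} (hc : c ≠ 0) :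
    (subst η t (monomial n c)).orderTop = weight t n ∧
    (subst η t (monomial n c)).leadingCoeff = Polynomial.monomial (n 1) c := by
  obtain ⟨h1, h2⟩ := subst_X_one_lead hη
  have hpow : ∀ k : ℕ, ((subst η t (X 1)) ^ k).orderTop = ((t * k : ℝ) : WithTop ℝ) ∧
      ((subst η t (X 1)) ^ k).leadingCoeff = Polynomial.X ^ k := by
    intro k
    induction k with
    | zero => simp
    | succ k ih =>
      rw [pow_succ, HahnSeries.orderTop_mul, HahnSeries.leadingCoeff_mul, ih.1, ih.2, h1, h2,
        ← WithTop.coe_add]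
      refine ⟨?_, by rw [pow_succ]⟩
      exact congrArg _ (by push_cast; ring)
  have hm : monomial n c = C c * ((X 0) ^ (n 0) * (X 1) ^ (n 1)) := by
    rw [monomial_eq, Finsupp.prod_fintype _ _ (by simp), Fin.prod_univ_two]
  have hC : subst η t (C c) = HahnSeries.single (0 : ℝ) (Polynomial.C c) := by
    rw [← MvPolynomial.algebraMap_eq, AlgHom.commutes, algebraMap_genSeries]
  have hCc : Polynomial.C c ≠ 0 := by simpa using hc
  rw [hm, map_mul, map_mul, map_pow, map_pow, hC, subst_X_zero, HahnSeries.single_pow,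
    HahnSeries.orderTop_mul, HahnSeries.leadingCoeff_mul, HahnSeries.orderTop_mul,
    HahnSeries.leadingCoeff_mul, (hpow _).1, (hpow _).2, HahnSeries.orderTop_single hCc,
    HahnSeries.leadingCoeff_of_single, HahnSeries.leadingCoeff_of_single,
    HahnSeries.orderTop_single (by simp)]
  constructor
  · rw [← WithTop.coe_add, ← WithTop.coe_add]
    simp [weight]
  · rw [one_pow, one_mul, Polynomial.C_mul_X_pow_eq_monomial]

/-- When `η` has order greater than `t`, the valuation `v_{η,t}` is monomial: no two monomials of
the same weight cancel, because their leading coefficients are distinct powers of `θ`. -/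
theorem le_val_iff_of_lt_orderTop
    (hη : (t : WithTop ℝ) < (toGenSeries η).orderTop) (f : Poly2) (m : ℝ) :
    (m : WithTop ℝ) ≤ val η t f ↔ ∀ n ∈ f.support, m ≤ weight t n := by
  have hsum : subst η t f = ∑ n ∈ f.support, subst η t (monomial n (coeff n f)) := by
    conv_lhs => rw [f.as_sum, map_sum]
  constructor
  · intro hm
    by_contra! hex
    obtain ⟨n₀, hn₀, hlt⟩ := hex
    obtain ⟨n, hn, hmin⟩ := Finset.exists_min_image f.support (weight t) ⟨n₀, hn₀⟩
    have hnm : weight t n < m := (hmin n₀ hn₀).trans_lt hlt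
    have h0 : (subst η t f).coeff (weight t n) = 0 :=
      HahnSeries.coeff_eq_zero_of_lt_orderTop ((WithTop.coe_lt_coe.2 hnm).trans_le hm)
    rw [hsum, HahnSeries.coeff_sum] at h0
    have h1 := congrArg (fun q : Polynomial ℂ => q.coeff (n 1)) h0
    simp only [Polynomial.finsetSum_coeff, Polynomial.coeff_zero] at h1
    rw [Finset.sum_eq_single n] at h1
    · obtain ⟨ho, hl⟩ := subst_monomial_lead hη n (mem_support_iff.1 hn)
      have hne : subst η t (monomial n (coeff n f)) ≠ 0 := by
        intro h; rw [h] at ho; simp at ho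
      rw [HahnSeries.leadingCoeff_eq] at hl
      rw [← HahnSeries.order_eq_orderTop_of_ne_zero hne, WithTop.coe_eq_coe] at ho
      rw [ho] at hl
      rw [hl, Polynomial.coeff_monomial, if_pos rfl] at h1
      exact mem_support_iff.1 hn h1
    · intro k hk hkn
      obtain ⟨ho, hl⟩ := subst_monomial_lead hη k (mem_support_iff.1 hk)
      rcases (hmin k hk).lt_or_eq with hlt | heq
      · rw [HahnSeries.coeff_eq_zero_of_lt_orderTop (by rw [ho]; exact WithTop.coe_lt_coe.2 hlt)]
        simp
      · have hne : subst η t (monomial k (coeff k f)) ≠ 0 := by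
          intro h; rw [h] at ho; simp at ho
        rw [HahnSeries.leadingCoeff_eq] at hl
        rw [← HahnSeries.order_eq_orderTop_of_ne_zero hne, WithTop.coe_eq_coe] at ho
        rw [ho, ← heq] at hl
        rw [hl, Polynomial.coeff_monomial, if_neg]
        intro h1
        apply hkn
        have h00 : (k 0 : ℝ) = n 0 := by
          have := heq
          simp only [weight, h1] at this
          linarith
        ext i
        fin_cases i
        · exact_mod_cast h00
        · exact h1
    · intro h; exact absurd hn h
  · intro h
    rw [val, HahnSeries.le_orderTop_iff_forall]
    intro j hj
    rw [hsum, HahnSeries.coeff_sum]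
    refine Finset.sum_eq_zero fun n hn => ?_
    apply HahnSeries.coeff_eq_zero_of_lt_orderTop
    rw [(subst_monomial_lead hη n (mem_support_iff.1 hn)).1]
    exact hj.trans_le (WithTop.coe_le_coe.2 (h n hn))

end Monomial

/-! ### The quasimonomial valuation -/

section Quasimonomial

variable {ξ : PowerSeries ℂ} {t : ℝ}

/-- In the coordinate `y - p(x)`, with `p` a truncation of `ξ` beyond degree `t`, the valuation
`v_{ξ,t}` becomes the monomial valuation of weights `1` and `t`. -/
theorem exists_shift_le_val_iff (hξ : PowerSeries.constantCoeff ξ = 0) (t : ℝ) :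
    ∃ p : Polynomial ℂ, p.coeff 0 = 0 ∧ ∀ (f : Poly2) (m : ℝ),
      (m : WithTop ℝ) ≤ val ξ t f ↔ ∀ n ∈ (shift p f).support, m ≤ weight t n := by
  refine ⟨PowerSeries.trunc (⌊t⌋₊ + 1) ξ, ?_, fun f m => ?_⟩
  · rw [PowerSeries.coeff_trunc, if_pos (by omega)]
    simpa using hξ
  · rw [← le_val_iff_of_lt_orderTop (η := ξ - (PowerSeries.trunc (⌊t⌋₊ + 1) ξ : PowerSeries ℂ)),
      val, val, subst_shift, sub_add_cancel]
    apply lt_orderTop_toGenSeries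
    intro i hi
    have : i < ⌊t⌋₊ + 1 := Nat.lt_succ_of_le (Nat.le_floor hi)
    simp [PowerSeries.coeff_trunc, this]

theorem subst_ne_zero (hξ : PowerSeries.constantCoeff ξ = 0) {f : Poly2} (hf : f ≠ 0) :
    subst ξ t f ≠ 0 := by
  obtain ⟨p, -, hp⟩ := exists_shift_le_val_iff hξ t
  intro h
  have hs : shift p f ≠ 0 := by simpa using hf
  obtain ⟨n, hn⟩ := support_nonempty.2 hs
  have := (hp f (weight t n + 1)).1 (by simp [val, h]) n hn
  linarith

/-- The value `v_{ξ,t}(f)` as a real number; it is meaningful for `f ≠ 0`. -/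
def ord (ξ : PowerSeries ℂ) (t : ℝ) (f : Poly2) : ℝ := (subst ξ t f).order

theorem val_eq_ord (hξ : PowerSeries.constantCoeff ξ = 0) {f : Poly2} (hf : f ≠ 0) :
    val ξ t f = (ord ξ t f : WithTop ℝ) :=
  (HahnSeries.order_eq_orderTop_of_ne_zero (subst_ne_zero hξ hf)).symm

theorem val_mul (f g : Poly2) : val ξ t (f * g) = val ξ t f + val ξ t g := by
  rw [val, map_mul, HahnSeries.orderTop_mul]; rfl

theorem val_zero : val ξ t 0 = ⊤ := by simp [val]

theorem ord_mul (hξ : PowerSeries.constantCoeff ξ = 0) {f g : Poly2} (hf : f ≠ 0) (hg : g ≠ 0) :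
    ord ξ t (f * g) = ord ξ t f + ord ξ t g := by
  rw [ord, map_mul, HahnSeries.order_mul (subst_ne_zero hξ hf) (subst_ne_zero hξ hg)]; rfl

theorem ord_one : ord ξ t 1 = 0 := by simp [ord]

theorem ord_pow (hξ : PowerSeries.constantCoeff ξ = 0) {f : Poly2} (hf : f ≠ 0) (k : ℕ) :
    ord ξ t (f ^ k) = k * ord ξ t f := by
  induction k with
  | zero => simp [ord_one]
  | succ k ih =>
    rw [pow_succ, ord_mul hξ (pow_ne_zero _ hf) hf, ih]
    push_cast
    ring

theorem val_nonneg (hξ : PowerSeries.constantCoeff ξ = 0) (ht : 1 ≤ t) (f : Poly2) :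
    0 ≤ val ξ t f := by
  obtain ⟨p, -, hp⟩ := exists_shift_le_val_iff hξ t
  exact (hp f 0).2 fun n _ => weight_nonneg ht n

theorem ord_nonneg (hξ : PowerSeries.constantCoeff ξ = 0) (ht : 1 ≤ t) {f : Poly2} (hf : f ≠ 0) :
    0 ≤ ord ξ t f := by
  have h := val_nonneg hξ ht f
  rw [val_eq_ord hξ hf] at h
  exact_mod_cast h

theorem val_eq_zero_of_constantCoeff_ne_zero (hξ : PowerSeries.constantCoeff ξ = 0) (ht : 1 ≤ t)
    {f : Poly2} (hf : constantCoeff f ≠ 0) : val ξ t f = 0 := by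
  obtain ⟨p, hp0, hp⟩ := exists_shift_le_val_iff hξ t
  have hf0 : f ≠ 0 := by rintro rfl; simp at hf
  refine le_antisymm ?_ (val_nonneg hξ ht f)
  have h1 := (hp f (ord ξ t f)).1 (val_eq_ord hξ hf0).ge 0 (by
    rw [mem_support_iff, ← constantCoeff_eq, constantCoeff_shift p hp0]; exact hf)
  rw [val_eq_ord hξ hf0]
  simp only [weight, Finsupp.coe_zero, Pi.zero_apply, Nat.cast_zero, mul_zero, add_zero] at h1
  exact_mod_cast h1

theorem ord_C (hξ : PowerSeries.constantCoeff ξ = 0) (ht : 1 ≤ t) {c : ℂ} (hc : c ≠ 0) :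
    ord ξ t (C c) = 0 := by
  have h := val_eq_zero_of_constantCoeff_ne_zero hξ ht (f := C c) (by simpa using hc)
  rw [val_eq_ord hξ (by simpa using hc)] at h
  exact_mod_cast h

/-- The values of `v_{ξ,t}` are at most linear in the degree. -/
theorem exists_ord_le_mul_totalDegree (hξ : PowerSeries.constantCoeff ξ = 0) (ht : 1 ≤ t) :
    ∃ K : ℝ, 0 ≤ K ∧ ∀ f : Poly2, f ≠ 0 → ord ξ t f ≤ K * f.totalDegree := by
  obtain ⟨p, -, hp⟩ := exists_shift_le_val_iff hξ t
  refine ⟨t * (max 1 p.natDegree : ℕ), by positivity, fun f hf => ?_⟩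
  have hs : shift p f ≠ 0 := by simpa using hf
  obtain ⟨n, hn⟩ := support_nonempty.2 hs
  have h1 := (hp f (ord ξ t f)).1 (val_eq_ord hξ hf).ge n hn
  have h2 : n.degree ≤ max 1 p.natDegree * f.totalDegree :=
    (le_totalDegree hn).trans (totalDegree_shift_le p f)
  calc ord ξ t f ≤ t * n.degree := h1.trans (weight_le_mul_degree ht n)
    _ ≤ t * (max 1 p.natDegree * f.totalDegree : ℕ) := by gcongr
    _ = _ := by push_cast; ring

end Quasimonomial

/-! ### The number of monomials of bounded weight -/

section Count

/-- The exponents of the monomials of weight less than `m`. -/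
def lowMonomials (t m : ℝ) : Set (Fin 2 →₀ ℕ) := {n | weight t n < m}

theorem lowMonomials_eq_image {t : ℝ} (ht : 1 ≤ t) (m : ℝ) {J : ℕ} (hJ : m ≤ t * J) :
    lowMonomials t m = (fun s : Σ _ : ℕ, ℕ => Finsupp.equivFunOnFinite.symm ![s.2, s.1]) ''
      ((Finset.range J).sigma fun j => Finset.range ⌈m - t * j⌉₊ : Finset (Σ _ : ℕ, ℕ)) := by
  ext n
  simp only [lowMonomials, weight, Set.mem_ofPred_eq, Set.mem_image, Finset.mem_coe,
    Finset.mem_sigma, Finset.mem_range, Nat.lt_ceil]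
  constructor
  · intro h
    refine ⟨⟨n 1, n 0⟩, ⟨?_, by dsimp only; linarith⟩, ?_⟩
    · by_contra! hle
      have : (J : ℝ) ≤ n 1 := by exact_mod_cast hle
      nlinarith [(n 0).cast_nonneg (α := ℝ)]
    · ext i
      fin_cases i <;> simp
  · rintro ⟨⟨j, i⟩, ⟨-, h⟩, rfl⟩
    simp only [Finsupp.coe_equivFunOnFinite_symm, Matrix.cons_val_zero, Matrix.cons_val_one]
    linarith

instance lowMonomials_finite {t m : ℝ} [ht : Fact (1 ≤ t)] : Finite (lowMonomials t m) := by
  have ht0 : 0 < t := by linarith [ht.out]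
  rw [Set.finite_coe_iff, lowMonomials_eq_image ht.out m (J := ⌈m / t⌉₊)
    (by rw [mul_comm, ← div_le_iff₀ ht0]; exact Nat.le_ceil _)]
  exact (Finset.finite_toSet _).image _

theorem card_lowMonomials {t : ℝ} (ht : 1 ≤ t) (m : ℝ) {J : ℕ} (hJ : m ≤ t * J) :
    Nat.card (lowMonomials t m) = ∑ j ∈ Finset.range J, ⌈m - t * j⌉₊ := by
  rw [lowMonomials_eq_image ht m hJ, Nat.card_coe_set_eq, Set.ncard_image_of_injective,
    Set.ncard_coe_finset, Finset.card_sigma]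
  · simp
  · rintro ⟨j, i⟩ ⟨j', i'⟩ h
    have h0 := DFunLike.congr_fun h 0
    have h1 := DFunLike.congr_fun h 1
    simp at h0 h1
    simp [h0, h1]

theorem sum_range_sub_mul (t m : ℝ) (J : ℕ) :
    ∑ j ∈ Finset.range J, (m - t * j) = J * m - t * (J * (J - 1) / 2) := by
  induction J with
  | zero => simp
  | succ k ih =>
    rw [Finset.sum_range_succ, ih]
    push_cast
    ring

theorem le_card_lowMonomials {t : ℝ} (ht : 1 ≤ t) {m : ℝ} (hm : 0 ≤ m) :
    m ^ 2 / (2 * t) ≤ Nat.card (lowMonomials t m) := by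
  have ht0 : 0 < t := by linarith
  have hJ1 : m / t ≤ ⌈m / t⌉₊ := Nat.le_ceil _
  have hJ2 : (⌈m / t⌉₊ : ℝ) < m / t + 1 := Nat.ceil_lt_add_one (by positivity)
  set J := ⌈m / t⌉₊ with hJ
  rw [div_le_iff₀ ht0] at hJ1
  have hJ3 : t * J < m + t := by
    calc t * J < t * (m / t + 1) := by gcongr
      _ = m + t := by field_simp
  rw [card_lowMonomials ht m (J := J) (by linarith)]
  push_cast
  have h1 : ∑ j ∈ Finset.range J, (m - t * j) ≤ ∑ j ∈ Finset.range J, (⌈m - t * j⌉₊ : ℝ) :=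
    Finset.sum_le_sum fun j _ => Nat.le_ceil _
  refine le_trans ?_ h1
  rw [sum_range_sub_mul, div_le_iff₀ (by positivity)]
  -- with `s = t J - m ∈ [0, t)` the difference of the two sides is `t ^ 2 J - s ^ 2`
  have hJt : (t * J - m) ^ 2 ≤ t * (t * J) := by
    rcases Nat.eq_zero_or_pos J with h0 | h0
    · have : m = 0 := by
        rw [h0] at hJ1; simp only [Nat.cast_zero, zero_mul] at hJ1; linarith
      rw [this, h0]; simp
    · have h1 : (1 : ℝ) ≤ J := by exact_mod_cast h0
      have h2 : t * 1 ≤ t * J := by gcongr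
      nlinarith
  nlinarith

theorem card_lowMonomials_le {t : ℝ} (ht : 1 ≤ t) {m : ℝ} (hm : 0 ≤ m) :
    (Nat.card (lowMonomials t m) : ℝ) ≤ (m + t + 1) ^ 2 / (2 * t) := by
  have ht0 : 0 < t := by linarith
  have hJ1 : m / t ≤ ⌈m / t⌉₊ := Nat.le_ceil _
  have hJ2 : (⌈m / t⌉₊ : ℝ) < m / t + 1 := Nat.ceil_lt_add_one (by positivity)
  set J := ⌈m / t⌉₊ with hJ
  rw [div_le_iff₀ ht0] at hJ1
  have hJ3 : t * J < m + t := by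
    calc t * J < t * (m / t + 1) := by gcongr
      _ = m + t := by field_simp
  rw [card_lowMonomials ht m (J := J) (by linarith)]
  push_cast
  have h1 : ∑ j ∈ Finset.range J, (⌈m - t * j⌉₊ : ℝ) ≤
      ∑ j ∈ Finset.range J, ((m + 1) - t * j) := by
    refine Finset.sum_le_sum fun j hj => ?_
    have hj' : j + 1 ≤ J := Finset.mem_range.1 hj
    have h2 : (j : ℝ) + 1 ≤ J := by exact_mod_cast hj'
    have h3 : t * (j + 1) ≤ t * J := by gcongr
    -- `J = ⌈m / t⌉` is least with `m ≤ t J`, so that `t j < m` and the ceiling does not truncate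
    linarith [Nat.ceil_lt_add_one (show 0 ≤ m - t * j by linarith)]
  refine h1.trans ?_
  rw [sum_range_sub_mul, le_div_iff₀ (by positivity)]
  nlinarith [sq_nonneg (t * J - m - (t + 1)), mul_nonneg ht0.le (by positivity : 0 ≤ t * J)]

theorem tendsto_card_lowMonomials {t : ℝ} (ht : 1 ≤ t) :
    Tendsto (fun m : ℝ => (Nat.card (lowMonomials t m) : ℝ) / (m ^ 2 / 2)) atTop (𝓝 (1 / t)) := by
  have ht0 : 0 < t := by linarith
  have hlim : Tendsto (fun m : ℝ => (1 + (t + 1) / m) ^ 2 / t) atTop (𝓝 (1 / t)) := by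
    have h1 : Tendsto (fun m : ℝ => (t + 1) / m) atTop (𝓝 0) := tendsto_id.const_div_atTop _
    have h2 := ((h1.const_add 1).pow 2).div_const t
    simpa using h2
  refine tendsto_of_tendsto_of_tendsto_of_le_of_le' tendsto_const_nhds hlim ?_ ?_
  · filter_upwards [eventually_gt_atTop 0] with m hm
    rw [le_div_iff₀ (by positivity)]
    refine le_trans (le_of_eq ?_) (le_card_lowMonomials ht hm.le)
    field_simp
  · filter_upwards [eventually_gt_atTop 0] with m hm
    rw [div_le_iff₀ (by positivity)]
    refine (card_lowMonomials_le ht hm.le).trans (le_of_eq ?_)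
    field_simp
    ring

theorem two_mul_finrank_restrictTotalDegree (D : ℕ) :
    2 * Module.finrank ℂ (restrictTotalDegree (Fin 2) ℂ D) = (D + 1) * (D + 2) := by
  have hset : {n : Fin 2 →₀ ℕ | (n.sum fun _ e => e) ≤ D} = lowMonomials 1 (D + 1) := by
    ext n
    simp only [Set.mem_ofPred_eq, lowMonomials, weight, one_mul]
    rw [Finsupp.sum_fintype _ _ (by simp), Fin.sum_univ_two, ← Nat.lt_succ_iff]
    exact_mod_cast Iff.rfl
  rw [restrictTotalDegree, Module.finrank_eq_nat_card_basis (basisRestrictSupport ℂ _), hset,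
    card_lowMonomials le_rfl _ (J := D + 1) (by push_cast; linarith), ← Finset.sum_range_reflect]
  have h : ∀ j ∈ Finset.range (D + 1),
      ⌈((D : ℝ) + 1) - 1 * ((D + 1 - 1 - j : ℕ) : ℝ)⌉₊ = j + 1 := by
    intro j hj
    have hj' : j ≤ D := Nat.lt_succ_iff.1 (Finset.mem_range.1 hj)
    rw [Nat.add_sub_cancel, Nat.cast_sub hj']
    have : (D : ℝ) + 1 - 1 * ((D : ℝ) - j) = ((j + 1 : ℕ) : ℝ) := by push_cast; ring
    rw [this, Nat.ceil_natCast]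
  rw [Finset.sum_congr rfl h]
  clear h hset
  induction D with
  | zero => simp
  | succ k ih =>
    rw [Finset.sum_range_succ, mul_add, ih]
    ring

end Count

/-! ### Colengths of valuation ideals and the volume -/

section Colength

variable {ξ : PowerSeries ℂ} {t : ℝ}

/-- Reading off the coefficients of low weight in adapted coordinates identifies the quotient by
`{f | m ≤ v(f)}` with the space of functions on the low monomials. -/
theorem exists_jet (hξ : PowerSeries.constantCoeff ξ = 0) (ht : 1 ≤ t) (m : ℝ) :
    ∃ L : Poly2 →ₗ[ℂ] (lowMonomials t m → ℂ), Function.Surjective L ∧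
      ∀ f, L f = 0 ↔ (m : WithTop ℝ) ≤ val ξ t f := by
  have : Fact (1 ≤ t) := ⟨ht⟩
  have := Fintype.ofFinite (lowMonomials t m)
  obtain ⟨p, -, hp⟩ := exists_shift_le_val_iff hξ t
  refine ⟨LinearMap.pi fun n => (lcoeff ℂ n.1).comp (shift p).toLinearMap, fun c => ?_, fun f => ?_⟩
  · refine ⟨(shift p).symm (∑ n, monomial n.1 (c n)), ?_⟩
    funext k
    simp only [LinearMap.pi_apply, LinearMap.comp_apply, AlgEquiv.toLinearMap_apply,
      AlgEquiv.apply_symm_apply, lcoeff_apply, coeff_sum, coeff_monomial]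
    rw [Finset.sum_eq_single k]
    · simp
    · intro n _ hn
      rw [if_neg fun h => hn (Subtype.ext h)]
    · simp
  · rw [hp]
    constructor
    · intro h n hn
      by_contra! hlt
      exact mem_support_iff.1 hn (congrFun h ⟨n, hlt⟩)
    · intro h
      funext n
      by_contra hne
      exact absurd (h n.1 (mem_support_iff.2 hne)) (not_le.2 n.2)

theorem mem_valIdeal_iff (hξ : PowerSeries.constantCoeff ξ = 0) (ht : 1 ≤ t) (m : ℝ) (f : Poly2) :
    f ∈ valIdeal (val ξ t) m ↔ (m : WithTop ℝ) ≤ val ξ t f := by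
  refine ⟨fun hf => ?_, fun hf => Ideal.subset_span hf⟩
  induction hf using Submodule.span_induction with
  | mem x hx => exact hx
  | zero => rw [val_zero]; exact le_top
  | add x y _ _ hx hy =>
    refine (le_min hx hy).trans ?_
    rw [val, val, val, map_add]
    exact HahnSeries.min_orderTop_le_orderTop_add
  | smul a x _ hx =>
    rw [smul_eq_mul, val_mul]
    exact hx.trans (le_add_of_nonneg_left (val_nonneg hξ ht a))

theorem val_mul_of_notMem_originIdeal (hξ : PowerSeries.constantCoeff ξ = 0) (ht : 1 ≤ t)
    {s : Poly2} (hs : s ∉ originIdeal) (f : Poly2) : val ξ t (s * f) = val ξ t f := by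
  rw [val_mul, val_eq_zero_of_constantCoeff_ne_zero hξ ht hs, zero_add]

theorem finrank_quotient_valIdealStalk (hξ : PowerSeries.constantCoeff ξ = 0) (ht : 1 ≤ t)
    (m : ℝ) : Module.finrank ℂ (LocalRing ⧸ valIdealStalk (val ξ t) m) =
      Nat.card (lowMonomials t m) := by
  have : Fact (1 ≤ t) := ⟨ht⟩
  have := Fintype.ofFinite (lowMonomials t m)
  obtain ⟨L, hL, hker⟩ := exists_jet hξ ht m
  let M : Poly2 →ₗ[ℂ] LocalRing ⧸ valIdealStalk (val ξ t) m :=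
    (IsScalarTower.toAlgHom ℂ Poly2 (LocalRing ⧸ valIdealStalk (val ξ t) m)).toLinearMap
  have hM : ∀ f, M f = Ideal.Quotient.mk _ (algebraMap Poly2 LocalRing f) := fun f => rfl
  have hMker : LinearMap.ker M = LinearMap.ker L := by
    ext f
    rw [LinearMap.mem_ker, LinearMap.mem_ker, hker, hM, Ideal.Quotient.eq_zero_iff_mem,
      valIdealStalk, IsLocalization.algebraMap_mem_map_algebraMap_iff originIdeal.primeCompl]
    constructor
    · rintro ⟨s, hs, h⟩
      rw [mem_valIdeal_iff hξ ht, val_mul_of_notMem_originIdeal hξ ht hs] at h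
      exact h
    · intro h
      exact ⟨1, one_mem _, by rw [one_mul, mem_valIdeal_iff hξ ht]; exact h⟩
  have hMsurj : Function.Surjective M := by
    intro z
    obtain ⟨z, rfl⟩ := Ideal.Quotient.mk_surjective z
    obtain ⟨r, s, rfl⟩ := IsLocalization.exists_mk'_eq originIdeal.primeCompl z
    -- multiplication by `s` is injective on the finite-dimensional quotient, hence surjective
    let T := L.comp (LinearMap.mulLeft ℂ (s : Poly2))
    have hT : LinearMap.ker T = LinearMap.ker L := by
      ext f
      rw [LinearMap.mem_ker, LinearMap.mem_ker, hker]
      change L (s * f) = 0 ↔ _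
      rw [hker, val_mul_of_notMem_originIdeal hξ ht s.2]
    have hTtop : LinearMap.range T = ⊤ := by
      apply Submodule.eq_top_of_finrank_eq
      rw [← T.quotKerEquivRange.finrank_eq, (Submodule.quotEquivOfEq _ _ hT).finrank_eq,
        (L.quotKerEquivOfSurjective hL).finrank_eq]
    obtain ⟨r', hr'⟩ := LinearMap.range_eq_top.1 hTtop (L r)
    have hr : L (s * r' - r) = 0 := by rw [map_sub, sub_eq_zero]; exact hr'
    refine ⟨r', ?_⟩
    rw [hM, Ideal.Quotient.eq]
    have hu := IsLocalization.map_units LocalRing s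
    rw [← Ideal.mul_unit_mem_iff_mem _ hu, sub_mul, IsLocalization.mk'_spec, ← map_mul, ← map_sub,
      mul_comm]
    exact Ideal.mem_map_of_mem _ ((mem_valIdeal_iff hξ ht _ _).2 ((hker _).1 hr))
  rw [← (M.quotKerEquivOfSurjective hMsurj).finrank_eq,
    (Submodule.quotEquivOfEq _ _ hMker).finrank_eq, (L.quotKerEquivOfSurjective hL).finrank_eq,
    Module.finrank_fintype_fun_eq_card, Nat.card_eq_fintype_card]

theorem tendsto_volRatio (hξ : PowerSeries.constantCoeff ξ = 0) (ht : 1 ≤ t) :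
    Tendsto (volRatio (val ξ t)) atTop (𝓝 (1 / t)) := by
  have h : volRatio (val ξ t) =
      fun m : ℝ => (Nat.card (lowMonomials t m) : ℝ) / (m ^ 2 / 2) := by
    funext m
    rw [volRatio, finrank_quotient_valIdealStalk hξ ht]
  rw [h]
  exact tendsto_card_lowMonomials ht

theorem vol_val (hξ : PowerSeries.constantCoeff ξ = 0) (ht : 1 ≤ t) :
    vol (val ξ t) = 1 / t :=
  (tendsto_volRatio hξ ht).limUnder_eq

end Colength

/-! ### Ranks of restricted linear maps -/

section LinearAlgebra

variable {K E F G : Type*} [Field K] [AddCommGroup E] [Module K E] [AddCommGroup F] [Module K F]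
  [AddCommGroup G] [Module K G]

theorem finrank_map_add_le (L : E →ₗ[K] F) {W V : Submodule K E} [FiniteDimensional K V]
    (h : W ≤ V) :
    Module.finrank K (V.map L) + Module.finrank K W ≤
      Module.finrank K (W.map L) + Module.finrank K V := by
  have : FiniteDimensional K W := Submodule.finiteDimensional_of_le h
  have hV := (L.domRestrict V).finrank_range_add_finrank_ker
  have hW := (L.domRestrict W).finrank_range_add_finrank_ker
  rw [LinearMap.range_domRestrict] at hV hW
  have hk : Module.finrank K (LinearMap.ker (L.domRestrict W)) ≤
      Module.finrank K (LinearMap.ker (L.domRestrict V)) := by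
    rw [← Submodule.finrank_map_subtype_eq W, ← Submodule.finrank_map_subtype_eq V]
    apply Submodule.finrank_mono
    rintro x ⟨⟨y, hy⟩, hxy, rfl⟩
    exact ⟨⟨y, h hy⟩, hxy, rfl⟩
  omega

theorem finrank_range_le_of_ker_le [FiniteDimensional K G] (T : E →ₗ[K] F) (S : E →ₗ[K] G)
    (h : LinearMap.ker S ≤ LinearMap.ker T) :
    Module.finrank K (LinearMap.range T) ≤ Module.finrank K (LinearMap.range S) := by
  rw [← T.quotKerEquivRange.finrank_eq, ← S.quotKerEquivRange.finrank_eq]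
  have : FiniteDimensional K (E ⧸ LinearMap.ker S) :=
    LinearEquiv.finiteDimensional S.quotKerEquivRange.symm
  exact (Submodule.factor h).finrank_le_finrank_of_surjective (Submodule.factor_surjective h)

end LinearAlgebra

/-! ### Bézout's inequality -/

section Bezout

/-- The multiples `f r` with `deg r ≤ D - deg f`. When `deg f ≤ D` and `f ≠ 0`, these are the
polynomials of degree at most `D` divisible by `f`; for `deg f > D` truncated subtraction leaves
the scalar multiples of `f`. -/
def multiples (f : Poly2) (D : ℕ) : Submodule ℂ Poly2 :=
  (restrictTotalDegree (Fin 2) ℂ (D - f.totalDegree)).map (LinearMap.mulLeft ℂ f)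

instance (f : Poly2) (D : ℕ) : FiniteDimensional ℂ (multiples f D) := by
  unfold multiples; infer_instance

theorem finrank_multiples {f : Poly2} (hf : f ≠ 0) (D : ℕ) :
    Module.finrank ℂ (multiples f D) =
      Module.finrank ℂ (restrictTotalDegree (Fin 2) ℂ (D - f.totalDegree)) :=
  (Submodule.equivMapOfInjective _ (mul_right_injective₀ hf) _).finrank_eq.symm

theorem multiples_le {f : Poly2} {D : ℕ} (h : f.totalDegree ≤ D) :
    multiples f D ≤ restrictTotalDegree (Fin 2) ℂ D := by
  rintro _ ⟨r, hr, rfl⟩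
  rw [SetLike.mem_coe, mem_restrictTotalDegree] at hr
  rw [mem_restrictTotalDegree]
  exact (totalDegree_mul _ _).trans (by omega)

theorem multiples_inf_multiples_le {f g : Poly2} (hf : f ≠ 0) (hg : g ≠ 0) (hfg : IsRelPrime f g)
    (D : ℕ) : multiples f D ⊓ multiples g D ≤ multiples (f * g) D := by
  rintro _ ⟨⟨r, hr, rfl⟩, ⟨s, hs, hrs⟩⟩
  rw [SetLike.mem_coe, mem_restrictTotalDegree] at hr hs
  simp only [LinearMap.mulLeft_apply] at hrs
  obtain ⟨q, rfl⟩ : g ∣ r := hfg.symm.dvd_of_dvd_mul_left ⟨s, hrs.symm⟩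
  refine ⟨q, ?_, by simp⟩
  rw [SetLike.mem_coe, mem_restrictTotalDegree, totalDegree_mul_of_isDomain hf hg]
  rcases eq_or_ne q 0 with rfl | hq
  · simp
  · rw [totalDegree_mul_of_isDomain hg hq] at hr
    omega

/-- The part of degree at most `D` of the ideal `(f, g)` has codimension at most `deg f * deg g`
in the space of polynomials of degree at most `D`. -/
theorem finrank_restrictTotalDegree_le {f g : Poly2} (hf : f ≠ 0) (hg : g ≠ 0)
    (hfg : IsRelPrime f g) {D : ℕ} (hD : f.totalDegree + g.totalDegree ≤ D) :
    Module.finrank ℂ (restrictTotalDegree (Fin 2) ℂ D) ≤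
      f.totalDegree * g.totalDegree +
        Module.finrank ℂ (multiples f D ⊔ multiples g D : Submodule ℂ Poly2) := by
  have h1 := Submodule.finrank_sup_add_finrank_inf_eq (multiples f D) (multiples g D)
  have h2 := Submodule.finrank_mono (multiples_inf_multiples_le hf hg hfg D)
  rw [finrank_multiples (mul_ne_zero hf hg), totalDegree_mul_of_isDomain hf hg] at h2
  rw [finrank_multiples hf, finrank_multiples hg] at h1
  obtain ⟨u, rfl⟩ := Nat.exists_eq_add_of_le hD
  have e0 := two_mul_finrank_restrictTotalDegree (f.totalDegree + g.totalDegree + u)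
  have e1 := two_mul_finrank_restrictTotalDegree (g.totalDegree + u)
  have e2 := two_mul_finrank_restrictTotalDegree (f.totalDegree + u)
  have e3 := two_mul_finrank_restrictTotalDegree u
  rw [show f.totalDegree + g.totalDegree + u - f.totalDegree = g.totalDegree + u by omega,
    show f.totalDegree + g.totalDegree + u - g.totalDegree = f.totalDegree + u by omega] at h1
  rw [show f.totalDegree + g.totalDegree + u - (f.totalDegree + g.totalDegree) = u by omega] at h2
  nlinarith

variable {ξ : PowerSeries ℂ} {t : ℝ}

/-- A multiple `f r` lies in the valuation ideal of level `m` as soon as `r` lies in that of level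
`m - v(f)`; hence the multiples of `f` have few jets of level `m`. -/
theorem finrank_map_multiples_le (hξ : PowerSeries.constantCoeff ξ = 0) (ht : 1 ≤ t) {m : ℝ}
    {L : Poly2 →ₗ[ℂ] (lowMonomials t m → ℂ)} (hL : ∀ f, L f = 0 ↔ (m : WithTop ℝ) ≤ val ξ t f)
    {f : Poly2} (hf : f ≠ 0) (D : ℕ) :
    Module.finrank ℂ ((multiples f D).map L) ≤ Nat.card (lowMonomials t (m - ord ξ t f)) := by
  have : Fact (1 ≤ t) := ⟨ht⟩
  have := Fintype.ofFinite (lowMonomials t m)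
  have := Fintype.ofFinite (lowMonomials t (m - ord ξ t f))
  obtain ⟨L', -, hL'⟩ := exists_jet hξ ht (m - ord ξ t f)
  have h1 : (multiples f D).map L ≤ LinearMap.range (L.comp (LinearMap.mulLeft ℂ f)) := by
    rintro _ ⟨_, ⟨r, -, rfl⟩, rfl⟩
    exact ⟨r, rfl⟩
  refine (Submodule.finrank_mono h1).trans ?_
  refine (finrank_range_le_of_ker_le _ L' ?_).trans ?_
  · intro r hr
    rw [LinearMap.mem_ker, hL'] at hr
    rw [LinearMap.mem_ker, LinearMap.comp_apply, LinearMap.mulLeft_apply, hL, val_mul,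
      val_eq_ord hξ hf]
    refine le_trans (le_of_eq ?_) (add_le_add_right hr _)
    rw [← WithTop.coe_add]
    simp
  · refine (Submodule.finrank_le _).trans ?_
    rw [Module.finrank_fintype_fun_eq_card, Nat.card_eq_fintype_card]

theorem exists_map_restrictTotalDegree_eq_top {F : Type*} [AddCommGroup F] [Module ℂ F]
    [FiniteDimensional ℂ F] {L : Poly2 →ₗ[ℂ] F} (hL : Function.Surjective L) :
    ∃ D₀, ∀ D, D₀ ≤ D → (restrictTotalDegree (Fin 2) ℂ D).map L = ⊤ := by
  choose r hr using hL
  let b := Module.finBasis ℂ F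
  refine ⟨Finset.univ.sup fun i => (r (b i)).totalDegree, fun D hD => ?_⟩
  rw [eq_top_iff, ← b.span_eq, Submodule.span_le]
  rintro _ ⟨i, rfl⟩
  refine ⟨r (b i), ?_, hr _⟩
  rw [SetLike.mem_coe, mem_restrictTotalDegree]
  exact (Finset.le_sup (f := fun i => (r (b i)).totalDegree) (Finset.mem_univ i)).trans hD

theorem card_lowMonomials_le_add (hξ : PowerSeries.constantCoeff ξ = 0) (ht : 1 ≤ t)
    {f g : Poly2} (hf : f ≠ 0) (hg : g ≠ 0) (hfg : IsRelPrime f g) (m : ℝ) :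
    Nat.card (lowMonomials t m) ≤ f.totalDegree * g.totalDegree +
      Nat.card (lowMonomials t (m - ord ξ t f)) + Nat.card (lowMonomials t (m - ord ξ t g)) := by
  have : Fact (1 ≤ t) := ⟨ht⟩
  have := Fintype.ofFinite (lowMonomials t m)
  obtain ⟨L, hLs, hL⟩ := exists_jet hξ ht m
  obtain ⟨D₀, hD₀⟩ := exists_map_restrictTotalDegree_eq_top hLs
  set D := max D₀ (f.totalDegree + g.totalDegree) with hD
  have hfD : f.totalDegree + g.totalDegree ≤ D := le_max_right _ _
  have htop := hD₀ D (le_max_left _ _)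
  have h1 : Module.finrank ℂ ((restrictTotalDegree (Fin 2) ℂ D).map L) +
      Module.finrank ℂ (multiples f D ⊔ multiples g D : Submodule ℂ Poly2) ≤
      Module.finrank ℂ ((multiples f D ⊔ multiples g D).map L) +
      Module.finrank ℂ (restrictTotalDegree (Fin 2) ℂ D) :=
    finrank_map_add_le L (W := multiples f D ⊔ multiples g D)
    (V := restrictTotalDegree (Fin 2) ℂ D)
    (sup_le (multiples_le (by omega)) (multiples_le (by omega)))
  rw [htop, finrank_top, Module.finrank_fintype_fun_eq_card, ← Nat.card_eq_fintype_card,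
    Submodule.map_sup] at h1
  have h2 := finrank_restrictTotalDegree_le hf hg hfg hfD
  have h3 := Submodule.finrank_add_le_finrank_add_finrank ((multiples f D).map L)
    ((multiples g D).map L)
  have h4 := finrank_map_multiples_le hξ ht hL hf D
  have h5 := finrank_map_multiples_le hξ ht hL hg D
  omega

/-- Comparison of the terms of order `k ^ 2` as `k → ∞`. -/
theorem mul_le_of_forall_sq_le {t a b x : ℝ} (ht : 0 < t) (ha : 0 ≤ a) (hb : 0 ≤ b)
    (h : ∀ k : ℕ, (k * (a + b)) ^ 2 / (2 * t) ≤
      k ^ 2 * x + (k * a + t + 1) ^ 2 / (2 * t) + (k * b + t + 1) ^ 2 / (2 * t)) :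
    a * b ≤ t * x := by
  have key : ∀ k : ℕ, (k : ℝ) ^ 2 * (a * b - t * x) ≤ k * ((t + 1) * (a + b)) + (t + 1) ^ 2 := by
    intro k
    have h4 := h k
    have h5 : ((k * (a + b)) ^ 2 - ((k * a + t + 1) ^ 2 + (k * b + t + 1) ^ 2)) / (2 * t) ≤
        k ^ 2 * x := by
      rw [sub_div, add_div]
      linarith
    rw [div_le_iff₀ (by positivity)] at h5
    linarith
  by_contra! hlt
  have hx0 : 0 < a * b - t * x := by linarith
  generalize a * b - t * x = y at key hx0
  have hC0 : 0 ≤ (t + 1) * (a + b) := by positivity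
  generalize (t + 1) * (a + b) = C at key hC0
  obtain ⟨k, hk⟩ := exists_nat_gt ((C + (t + 1) ^ 2) / y)
  have hk0 : (0 : ℝ) ≤ (C + (t + 1) ^ 2) / y := by positivity
  have hk1 : (1 : ℝ) ≤ k := by
    have : 0 < k := by exact_mod_cast hk0.trans_lt hk
    exact_mod_cast this
  rw [div_lt_iff₀ hx0] at hk
  have h1 := key k
  have h2 : (k : ℝ) * (C + (t + 1) ^ 2) < k * (k * y) := by gcongr
  nlinarith [sq_nonneg (t + 1)]

theorem totalDegree_pow_of_ne_zero {f : Poly2} (hf : f ≠ 0) (k : ℕ) :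
    (f ^ k).totalDegree = k * f.totalDegree := by
  induction k with
  | zero => simp
  | succ k ih =>
    rw [pow_succ, totalDegree_mul_of_isDomain (pow_ne_zero _ hf) hf, ih]
    ring

/-- **Bézout's inequality** for the quasimonomial valuation: geometrically, `v(f) v(g) / t` is at
most the intersection multiplicity of `f` and `g` at the origin, which is at most `deg f * deg g`.
Jets are counted for high powers `f ^ k`, `g ^ k`, so that only the leading term `m ^ 2 / (2 t)` of
the number of monomials of weight less than `m` matters. -/
theorem ord_mul_ord_le (hξ : PowerSeries.constantCoeff ξ = 0) (ht : 1 ≤ t)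
    {f g : Poly2} (hf : f ≠ 0) (hg : g ≠ 0) (hfg : IsRelPrime f g) :
    ord ξ t f * ord ξ t g ≤ t * (f.totalDegree * g.totalDegree) := by
  have ha := ord_nonneg hξ ht hf
  have hb := ord_nonneg hξ ht hg
  refine mul_le_of_forall_sq_le (by linarith) ha hb fun k => ?_
  have h := card_lowMonomials_le_add hξ ht (pow_ne_zero k hf) (pow_ne_zero k hg)
    hfg.pow_left.pow_right (k * (ord ξ t f + ord ξ t g))
  rw [ord_pow hξ hf, ord_pow hξ hg, totalDegree_pow_of_ne_zero hf, totalDegree_pow_of_ne_zero hg]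
    at h
  generalize ord ξ t f = a at *
  generalize ord ξ t g = b at *
  rw [show k * (a + b) - k * a = k * b by ring, show k * (a + b) - k * b = k * a by ring] at h
  have h' : (Nat.card (lowMonomials t (k * (a + b))) : ℝ) ≤
      (k * f.totalDegree) * (k * g.totalDegree) + Nat.card (lowMonomials t (k * b)) +
        Nat.card (lowMonomials t (k * a)) := by exact_mod_cast h
  have h1 := le_card_lowMonomials ht (m := k * (a + b)) (by positivity)
  have h2 := card_lowMonomials_le ht (m := k * a) (by positivity)
  have h3 := card_lowMonomials_le ht (m := k * b) (by positivity)
  linarith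

end Bezout

/-! ### Forms in three variables and polynomials in two -/

section Homogenization

theorem dehom_eq_sum (F : MvPolynomial (Fin 3) ℂ) :
    dehom F = ∑ i ∈ (finSuccEquiv ℂ 2 F).support, (finSuccEquiv ℂ 2 F).coeff i := by
  have h : dehom = ((Polynomial.aeval (1 : Poly2)).restrictScalars ℂ).comp
      (finSuccEquiv ℂ 2 : MvPolynomial (Fin 3) ℂ →ₐ[ℂ] Polynomial Poly2) := by
    apply MvPolynomial.algHom_ext
    intro i
    refine Fin.cases ?_ (fun j => ?_) i
    · simp [dehom, finSuccEquiv_X_zero]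
    · have h1 : dehom (X j.succ) = X j := by
        fin_cases j <;> simp [dehom]
      rw [h1, AlgHom.comp_apply]
      change _ = Polynomial.aeval (1 : Poly2) (finSuccEquiv ℂ 2 (X j.succ))
      rw [finSuccEquiv_X_succ, Polynomial.aeval_C]
      rfl
  rw [h]
  change Polynomial.aeval (1 : Poly2) (finSuccEquiv ℂ 2 F) = _
  rw [Polynomial.aeval_def, Polynomial.eval₂_eq_sum, Polynomial.sum_def]
  simp

theorem coeff_finSuccEquiv_of_isHomogeneous {F : MvPolynomial (Fin 3) ℂ} {d i : ℕ}
    (hF : F.IsHomogeneous d) (hi : i ∈ (finSuccEquiv ℂ 2 F).support) :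
    i ≤ d ∧ ((finSuccEquiv ℂ 2 F).coeff i).IsHomogeneous (d - i) := by
  have hid : i ≤ d := by
    have h1 := Polynomial.le_natDegree_of_mem_supp i hi
    rw [natDegree_finSuccEquiv] at h1
    exact h1.trans ((degreeOf_le_totalDegree F 0).trans hF.totalDegree_le)
  exact ⟨hid, hF.finSuccEquiv_coeff_isHomogeneous _ _ (by omega)⟩

theorem totalDegree_dehom_le {F : MvPolynomial (Fin 3) ℂ} {d : ℕ} (hF : F.IsHomogeneous d) :
    (dehom F).totalDegree ≤ d := by
  rw [dehom_eq_sum]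
  refine (totalDegree_finsetSum _ _).trans (Finset.sup_le fun i hi => ?_)
  exact (coeff_finSuccEquiv_of_isHomogeneous hF hi).2.totalDegree_le.trans (Nat.sub_le _ _)

/-- Dehomogenization loses nothing: the coefficients of `F` as a polynomial in `w₁` are the
homogeneous components of `F(1, x, y)`. -/
theorem dehom_ne_zero {F : MvPolynomial (Fin 3) ℂ} {d : ℕ} (hF : F.IsHomogeneous d)
    (hF0 : F ≠ 0) : dehom F ≠ 0 := by
  intro h0
  have hq : finSuccEquiv ℂ 2 F ≠ 0 := by simpa using hF0
  obtain ⟨i, hi⟩ := Polynomial.nonempty_support_iff.2 hq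
  have h1 := congrArg (homogeneousComponent (d - i)) h0
  rw [dehom_eq_sum, map_sum, map_zero, Finset.sum_eq_single i] at h1
  · rw [homogeneousComponent_of_mem (coeff_finSuccEquiv_of_isHomogeneous hF hi).2, if_pos rfl] at h1
    exact Polynomial.mem_support_iff.1 hi h1
  · intro j hj hji
    have h2 := (coeff_finSuccEquiv_of_isHomogeneous hF hi).1
    have h3 := (coeff_finSuccEquiv_of_isHomogeneous hF hj)
    rw [homogeneousComponent_of_mem h3.2, if_neg]
    omega
  · exact fun h => absurd hi h

theorem exists_dehom_eq {f : Poly2} {d : ℕ} (hf : f.totalDegree ≤ d) :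
    ∃ F : MvPolynomial (Fin 3) ℂ, F.IsHomogeneous d ∧ dehom F = f := by
  refine ⟨∑ i ∈ Finset.range (f.totalDegree + 1),
    X 0 ^ (d - i) * rename Fin.succ (homogeneousComponent i f), ?_, ?_⟩
  · refine IsHomogeneous.sum _ _ _ fun i hi => ?_
    have hi' : i ≤ d := (Nat.lt_succ_iff.1 (Finset.mem_range.1 hi)).trans hf
    have := (isHomogeneous_X_pow (R := ℂ) (0 : Fin 3) (d - i)).mul
      ((homogeneousComponent_isHomogeneous i f).rename_isHomogeneous (f := Fin.succ))
    rwa [Nat.sub_add_cancel hi'] at this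
  · have hr : ∀ g : Poly2, dehom (rename Fin.succ g) = g := by
      intro g
      rw [dehom, aeval_rename]
      have : (![1, X 0, X 1] : Fin 3 → Poly2) ∘ Fin.succ = X := by
        funext i; fin_cases i <;> rfl
      rw [this, aeval_X_left_apply]
    have hX : dehom (X 0) = 1 := by simp [dehom]
    rw [map_sum]
    simp only [map_mul, map_pow, hX, one_pow, one_mul, hr]
    exact sum_homogeneousComponent f

end Homogenization

/-! ### The constant `μ̂` -/

section Mu

variable {ξ : PowerSeries ℂ} {t : ℝ}

theorem mu_eq_sSup (hξ : PowerSeries.constantCoeff ξ = 0) (d : ℕ) :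
    mu (val ξ t) d =
      sSup {m : ℤ | ∃ f : Poly2, f ≠ 0 ∧ f.totalDegree ≤ d ∧ (m : ℝ) ≤ ord ξ t f} := by
  unfold mu
  congr 1
  ext m
  constructor
  · rintro ⟨F, hF0, hF, hm⟩
    have h0 := dehom_ne_zero hF hF0
    rw [val_eq_ord hξ h0, WithTop.coe_le_coe] at hm
    exact ⟨dehom F, h0, totalDegree_dehom_le hF, hm⟩
  · rintro ⟨f, hf0, hf, hm⟩
    obtain ⟨F, hF, rfl⟩ := exists_dehom_eq hf
    refine ⟨F, ?_, hF, ?_⟩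
    · rintro rfl
      simp at hf0
    · rw [val_eq_ord hξ hf0, WithTop.coe_le_coe]
      exact hm

theorem bddAbove_mu (hξ : PowerSeries.constantCoeff ξ = 0) (ht : 1 ≤ t) (d : ℕ) :
    BddAbove {m : ℤ | ∃ f : Poly2, f ≠ 0 ∧ f.totalDegree ≤ d ∧ (m : ℝ) ≤ ord ξ t f} := by
  obtain ⟨K, hK0, hK⟩ := exists_ord_le_mul_totalDegree hξ ht
  refine ⟨⌊K * d⌋, ?_⟩
  rintro m ⟨f, hf0, hf, hm⟩
  rw [Int.le_floor]
  refine hm.trans ((hK f hf0).trans ?_)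
  gcongr

theorem le_mu (hξ : PowerSeries.constantCoeff ξ = 0) (ht : 1 ≤ t) {f : Poly2} (hf : f ≠ 0)
    {d : ℕ} (hd : f.totalDegree ≤ d) {m : ℤ} (hm : (m : ℝ) ≤ ord ξ t f) :
    m ≤ mu (val ξ t) d := by
  rw [mu_eq_sSup hξ]
  exact le_csSup (bddAbove_mu hξ ht d) ⟨f, hf, hd, hm⟩

theorem exists_mu_le_ord (hξ : PowerSeries.constantCoeff ξ = 0) (ht : 1 ≤ t) (d : ℕ) :
    ∃ f : Poly2, f ≠ 0 ∧ f.totalDegree ≤ d ∧ (mu (val ξ t) d : ℝ) ≤ ord ξ t f := by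
  rw [mu_eq_sSup hξ]
  refine Int.csSup_mem
    (s := {m : ℤ | ∃ f : Poly2, f ≠ 0 ∧ f.totalDegree ≤ d ∧ (m : ℝ) ≤ ord ξ t f})
    ⟨0, 1, one_ne_zero, by simp, by simp [ord_one]⟩ (bddAbove_mu hξ ht d)

theorem subadditive_neg_mu (hξ : PowerSeries.constantCoeff ξ = 0) (ht : 1 ≤ t) :
    Subadditive fun d => -(mu (val ξ t) d : ℝ) := by
  intro d e
  obtain ⟨f, hf0, hf, hfm⟩ := exists_mu_le_ord hξ ht d
  obtain ⟨g, hg0, hg, hgm⟩ := exists_mu_le_ord hξ ht e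
  have h := le_mu hξ ht (mul_ne_zero hf0 hg0) (d := d + e)
    ((totalDegree_mul _ _).trans (add_le_add hf hg))
    (m := mu (val ξ t) d + mu (val ξ t) e) (by
      rw [ord_mul hξ hf0 hg0]
      push_cast
      exact add_le_add hfm hgm)
  have h' : (mu (val ξ t) d : ℝ) + mu (val ξ t) e ≤ mu (val ξ t) (d + e) := by exact_mod_cast h
  dsimp only
  linarith

theorem bddBelow_neg_mu_div (hξ : PowerSeries.constantCoeff ξ = 0) (ht : 1 ≤ t) :
    BddBelow (Set.range fun d : ℕ => -(mu (val ξ t) d : ℝ) / d) := by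
  obtain ⟨K, hK0, hK⟩ := exists_ord_le_mul_totalDegree hξ ht
  refine ⟨-K, ?_⟩
  rintro _ ⟨d, rfl⟩
  obtain ⟨f, hf0, hf, hfm⟩ := exists_mu_le_ord hξ ht d
  have h : (mu (val ξ t) d : ℝ) ≤ K * d := hfm.trans ((hK f hf0).trans (by gcongr))
  dsimp only
  rw [neg_div, neg_le_neg_iff]
  exact div_le_of_le_mul₀ (by positivity) hK0 h

theorem tendsto_mu_div (hξ : PowerSeries.constantCoeff ξ = 0) (ht : 1 ≤ t) :
    Tendsto (fun d : ℕ => (mu (val ξ t) d : ℝ) / d) atTop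
      (𝓝 (-(subadditive_neg_mu hξ ht).lim)) := by
  have h := ((subadditive_neg_mu hξ ht).tendsto_lim (bddBelow_neg_mu_div hξ ht)).neg
  refine h.congr fun d => ?_
  rw [neg_div, neg_neg]

theorem muHat_val (hξ : PowerSeries.constantCoeff ξ = 0) (ht : 1 ≤ t) :
    muHat (val ξ t) = -(subadditive_neg_mu hξ ht).lim :=
  (tendsto_mu_div hξ ht).limUnder_eq

theorem mu_le_muHat_mul (hξ : PowerSeries.constantCoeff ξ = 0) (ht : 1 ≤ t) {d : ℕ} (hd : d ≠ 0) :
    (mu (val ξ t) d : ℝ) ≤ muHat (val ξ t) * d := by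
  have h := (subadditive_neg_mu hξ ht).lim_le_div (bddBelow_neg_mu_div hξ ht) hd
  have hd0 : (0 : ℝ) < d := by exact_mod_cast Nat.pos_of_ne_zero hd
  rw [le_div_iff₀ hd0] at h
  rw [muHat_val hξ ht]
  linarith

theorem ord_eq_zero_of_totalDegree_eq_zero (hξ : PowerSeries.constantCoeff ξ = 0) (ht : 1 ≤ t)
    {f : Poly2} (hf : f ≠ 0) (h : f.totalDegree = 0) : ord ξ t f = 0 := by
  obtain ⟨c, rfl⟩ : ∃ c, f = C c := ⟨_, totalDegree_eq_zero_iff_eq_C.1 h⟩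
  exact ord_C hξ ht (by simpa using hf)

/-- Powers of `f` are among the forms that compete for `μ_d`, so that `μ̂` bounds `v(f) / deg f`;
the rounding in `μ_d` disappears in the limit. -/
theorem ord_le_muHat_mul (hξ : PowerSeries.constantCoeff ξ = 0) (ht : 1 ≤ t) {f : Poly2}
    (hf : f ≠ 0) : ord ξ t f ≤ muHat (val ξ t) * f.totalDegree := by
  rcases Nat.eq_zero_or_pos f.totalDegree with h0 | hpos
  · rw [h0, ord_eq_zero_of_totalDegree_eq_zero hξ ht hf h0]
    simp
  by_contra! hlt
  obtain ⟨k, hk⟩ := exists_nat_gt (1 / (ord ξ t f - muHat (val ξ t) * f.totalDegree))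
  have hx : 0 < ord ξ t f - muHat (val ξ t) * f.totalDegree := by linarith
  have hk0 : 0 < k := by
    have : (0 : ℝ) < k := lt_trans (by positivity) hk
    exact_mod_cast this
  rw [div_lt_iff₀ hx] at hk
  have h1 := le_mu hξ ht (pow_ne_zero k hf) (d := k * f.totalDegree)
    (totalDegree_pow_of_ne_zero hf k).le (m := ⌊ord ξ t (f ^ k)⌋) (Int.floor_le _)
  have h2 : ((⌊ord ξ t (f ^ k)⌋ : ℤ) : ℝ) ≤ mu (val ξ t) (k * f.totalDegree) := by
    exact_mod_cast h1
  have h3 := mu_le_muHat_mul hξ ht (d := k * f.totalDegree) (by positivity)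
  have h4 := Int.lt_floor_add_one (ord ξ t (f ^ k))
  rw [ord_pow hξ hf] at h4 h2
  push_cast at h3
  nlinarith

/-- A linear bound of the valuation by the degree may be checked on irreducible polynomials. -/
theorem ord_le_mul_of_forall_irreducible (hξ : PowerSeries.constantCoeff ξ = 0) (ht : 1 ≤ t)
    {c : ℝ} (h : ∀ f : Poly2, Irreducible f → ord ξ t f ≤ c * f.totalDegree) {f : Poly2}
    (hf : f ≠ 0) : ord ξ t f ≤ c * f.totalDegree := by
  induction f using WfDvdMonoid.induction_on_irreducible with
  | zero => exact absurd rfl hf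
  | unit u hu =>
    have h0 : u.totalDegree = 0 := by
      have := totalDegree_le_of_dvd_of_isDomain hu.dvd (one_ne_zero (α := Poly2))
      simpa using this
    rw [ord_eq_zero_of_totalDegree_eq_zero hξ ht hf h0, h0]
    simp
  | mul a i ha hi ih =>
    rw [ord_mul hξ hi.ne_zero ha, totalDegree_mul_of_isDomain hi.ne_zero ha]
    push_cast
    linarith [h i hi, ih ha]

theorem muHat_le_of_forall_irreducible (hξ : PowerSeries.constantCoeff ξ = 0) (ht : 1 ≤ t)
    {c : ℝ} (hc : 0 ≤ c) (h : ∀ f : Poly2, Irreducible f → ord ξ t f ≤ c * f.totalDegree) :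
    muHat (val ξ t) ≤ c := by
  refine le_of_tendsto' (by rw [muHat_val hξ ht]; exact tendsto_mu_div hξ ht) fun d => ?_
  obtain ⟨f, hf0, hf, hfm⟩ := exists_mu_le_ord hξ ht d
  refine div_le_of_le_mul₀ (by positivity) hc (hfm.trans ?_)
  exact (ord_le_mul_of_forall_irreducible hξ ht h hf0).trans (by gcongr)

/-- An irreducible polynomial whose value exceeds `√t * deg f` computes `μ̂`: any other irreducible
polynomial `g` is coprime to it, and Bézout's inequality keeps `v(g) / deg g` below `√t`. -/
theorem ord_eq_muHat_mul (hξ : PowerSeries.constantCoeff ξ = 0) (ht : 1 ≤ t) {f : Poly2}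
    (hf : Irreducible f) (h : √t * f.totalDegree < ord ξ t f) :
    ord ξ t f = muHat (val ξ t) * f.totalDegree := by
  have hf0 := hf.ne_zero
  have hord : 0 < ord ξ t f := lt_of_le_of_lt (by positivity) h
  have hdeg : (0 : ℝ) < f.totalDegree := by
    have : f.totalDegree ≠ 0 := fun h0 =>
      hord.ne' (ord_eq_zero_of_totalDegree_eq_zero hξ ht hf0 h0)
    exact_mod_cast Nat.pos_of_ne_zero this
  refine le_antisymm (ord_le_muHat_mul hξ ht hf0) ?_
  rw [← le_div_iff₀ hdeg]
  refine muHat_le_of_forall_irreducible hξ ht (by positivity) fun g hg => ?_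
  rw [div_mul_eq_mul_div, le_div_iff₀ hdeg]
  rcases hf.dvd_or_isRelPrime (n := g) with hfg | hfg
  · obtain ⟨u, rfl⟩ := hf.associated_of_dvd hg hfg
    have hu0 : (u : Poly2).totalDegree = 0 := by
      have := totalDegree_le_of_dvd_of_isDomain u.isUnit.dvd (one_ne_zero (α := Poly2))
      simpa using this
    rw [ord_mul hξ hf0 u.ne_zero, totalDegree_mul_of_isDomain hf0 u.ne_zero, hu0,
      ord_eq_zero_of_totalDegree_eq_zero hξ ht u.ne_zero hu0]
    simp
  · have h1 := ord_mul_ord_le hξ ht hf0 hg.ne_zero hfg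
    have h2 : t * (f.totalDegree : ℝ) ^ 2 ≤ ord ξ t f ^ 2 := by
      have := pow_le_pow_left₀ (by positivity) h.le 2
      rwa [mul_pow, Real.sq_sqrt (by linarith)] at this
    refine le_of_mul_le_mul_left ?_ hord
    calc ord ξ t f * (ord ξ t g * f.totalDegree)
        = (ord ξ t f * ord ξ t g) * f.totalDegree := by ring
      _ ≤ (t * (f.totalDegree * g.totalDegree)) * f.totalDegree := by gcongr
      _ = (t * (f.totalDegree : ℝ) ^ 2) * g.totalDegree := by ring
      _ ≤ ord ξ t f ^ 2 * g.totalDegree := by gcongr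
      _ = ord ξ t f * (ord ξ t f * g.totalDegree) := by ring

end Mu

end QuasiMonomial

end

theorem mainTheorem8 (ξ : PowerSeries ℂ) (hξ : PowerSeries.constantCoeff ξ = 0)
    (t : ℝ) (ht : 1 ≤ t) :
    -- the limits that define the volume and `μ̂` exist, and the volume is positive
    Tendsto (QuasiMonomial.volRatio (QuasiMonomial.val ξ t)) atTop
      (𝓝 (QuasiMonomial.vol (QuasiMonomial.val ξ t))) ∧
    0 < QuasiMonomial.vol (QuasiMonomial.val ξ t) ∧
    Tendsto (fun d : ℕ => (QuasiMonomial.mu (QuasiMonomial.val ξ t) d : ℝ) / (d : ℝ)) atTop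
      (𝓝 (QuasiMonomial.muHat (QuasiMonomial.val ξ t))) ∧
    -- an irreducible submaximal polynomial computes `μ̂`
    (∀ f : MvPolynomial (Fin 2) ℂ, Irreducible f →
      (((1 / √(QuasiMonomial.vol (QuasiMonomial.val ξ t)) * (f.totalDegree : ℝ) : ℝ)) : WithTop ℝ)
        < QuasiMonomial.val ξ t f →
      QuasiMonomial.val ξ t f =
        ((QuasiMonomial.muHat (QuasiMonomial.val ξ t) * (f.totalDegree : ℝ) : ℝ) : WithTop ℝ)) ∧
    -- if `μ̂` exceeds the bound given by the volume, such a polynomial exists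
    (1 / √(QuasiMonomial.vol (QuasiMonomial.val ξ t)) <
        QuasiMonomial.muHat (QuasiMonomial.val ξ t) →
      ∃ f : MvPolynomial (Fin 2) ℂ, Irreducible f ∧
        (((1 / √(QuasiMonomial.vol (QuasiMonomial.val ξ t)) * (f.totalDegree : ℝ) : ℝ)) :
          WithTop ℝ) < QuasiMonomial.val ξ t f) := by
  have hvol : 1 / √(QuasiMonomial.vol (QuasiMonomial.val ξ t)) = √t := by
    rw [QuasiMonomial.vol_val hξ ht, one_div, one_div, Real.sqrt_inv, inv_inv]
  refine ⟨?_, ?_, ?_, ?_, ?_⟩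
  · rw [QuasiMonomial.vol_val hξ ht]
    exact QuasiMonomial.tendsto_volRatio hξ ht
  · rw [QuasiMonomial.vol_val hξ ht]
    positivity
  · rw [QuasiMonomial.muHat_val hξ ht]
    exact QuasiMonomial.tendsto_mu_div hξ ht
  · intro f hf h
    rw [hvol, QuasiMonomial.val_eq_ord hξ hf.ne_zero, WithTop.coe_lt_coe] at h
    rw [QuasiMonomial.val_eq_ord hξ hf.ne_zero, WithTop.coe_eq_coe]
    exact QuasiMonomial.ord_eq_muHat_mul hξ ht hf h
  · intro h
    by_contra! hall
    refine absurd h (not_lt.2 ?_)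
    rw [hvol] at hall ⊢
    refine QuasiMonomial.muHat_le_of_forall_irreducible hξ ht (Real.sqrt_nonneg t) fun f hf => ?_
    have h1 := hall f hf
    rwa [QuasiMonomial.val_eq_ord hξ hf.ne_zero, WithTop.coe_le_coe] at h1
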